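/- For $r\ge 0$, integers $k_1,\dots,k_r\ge 1$ and polynomials $Q_1,\dots,Q_r\in\mathbb{Q}[X]$ with $\deg Q_j\le k_j$ for all $j$ and, if $r\ge 1$, $Q_r\in X\mathbb{Q}[X]$, define the $q$-multiple zeta value \[ \zeta_q(k_1,\dots,k_r;Q_1,\dots,Q_r):=\sum_{0<n_1<\cdots<n_r}\ \prod_{j=1}^r\frac{Q_j(q^{n_j})}{(1-q^{n_j})^{k_j}}\in\mathbb{Q}[[q]], \] with $\zeta_q(\emptyset;\emptyset):=1$ for $r=0$. For $d\in\{0,1\}$ let \begin{align*} \mathcal{Z}_{q,d}&:=\mathrm{span}_{\mathbb{Q}}\bigl\{\zeta_q(k_1,\dots,k_r;Q_1,\dots,Q_r)\bigm| r\ge 0,\ k_j\ge 1,\ \deg Q_j\le k_j-d \text{ for all } j,\ Q_r\in X\mathbb{Q}[X]\bigr\},\\ \mathcal{Z}_{q,d}^{\circ}&:=\mathrm{span}_{\mathbb{Q}}\bigl\{\zeta_q(k_1,\dots,k_r;Q_1,\dots,Q_r)\bigm| r\ge 0,\ k_j\ge 1,\ \deg Q_j\le k_j-d \text{ and } Q_j\in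 X\mathbb{Q}[X] \text{ for all } j\bigr\}, \end{align*} where the condition $Q_r\in X\mathbb{Q}[X]$ is void for $r=0$, and write $\mathcal{Z}_q:=\mathcal{Z}_{q,0}$ and $\mathcal{Z}_q^{\circ}:=\mathcal{Z}_{q,0}^{\circ}$. Then \[ \mathcal{Z}_q^{\circ}=\mathcal{Z}_q\qquad\text{and}\qquad \mathcal{Z}_{q,1}^{\circ}=\mathcal{Z}_{q,1}. \] -/

import Mathlib

open PowerSeries

namespace QMZV

/-- The summand `∏ j, Q_j(q^{n_j}) / (1 - q^{n_j})^{k_j}` in `ℚ⟦q⟧`, the variable of the power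
series ring being `q`. For `n_j ≥ 1` the denominator has constant coefficient `1`, so `⁻¹` is its
genuine inverse. -/
noncomputable def zetaTerm {r : ℕ} (k : Fin r → ℕ) (Q : Fin r → Polynomial ℚ) (n : Fin r → ℕ) :
    ℚ⟦X⟧ :=
  ∏ j, Polynomial.aeval ((X : ℚ⟦X⟧) ^ n j) (Q j) * ((1 - (X : ℚ⟦X⟧) ^ n j) ^ k j)⁻¹

/-- The index set `0 < n_1 < ⋯ < n_r` (for `r = 0` it consists of the empty tuple). -/
def indexSet (r : ℕ) : Set (Fin r → ℕ) :=
  {n | StrictMono n ∧ ∀ j, 0 < n j}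

/-- The last polynomial `Q_r` is in `X ℚ[X]` (no condition if `r = 0`). -/
def LastDvd {r : ℕ} (Q : Fin r → Polynomial ℚ) : Prop :=
  ∀ j : Fin r, (j : ℕ) + 1 = r → Polynomial.X ∣ Q j

/-- The `q`-multiple zeta value `ζ_q(k_1,…,k_r;Q_1,…,Q_r)`: the sum of the formal power series
`zetaTerm k Q n` over `0 < n_1 < ⋯ < n_r`, taken coefficient by coefficient. Each coefficient is a
sum with finitely many nonzero terms when `Q_r ∈ X ℚ[X]`, see `finite_support_coeff`. -/
noncomputable def zeta {r : ℕ} (k : Fin r → ℕ) (Q : Fin r → Polynomial ℚ) : ℚ⟦X⟧ :=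
  PowerSeries.mk fun m => ∑ᶠ n ∈ indexSet r, coeff m (zetaTerm k Q n)

theorem finite_support_coeff {r : ℕ} (k : Fin r → ℕ) (Q : Fin r → Polynomial ℚ)
    (hQ : LastDvd Q) (m : ℕ) :
    {n | n ∈ indexSet r ∧ coeff m (zetaTerm k Q n) ≠ 0}.Finite := by
  refine (Set.finite_Iic (fun _ : Fin r => m)).subset ?_
  rintro n ⟨⟨hmono, -⟩, hne⟩ i
  by_contra hi
  apply hne
  have hr : 0 < r := i.pos
  let l : Fin r := ⟨r - 1, by omega⟩
  have hl : m < n l := by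
    have h : n i ≤ n l := hmono.monotone (by
      rw [Fin.le_def]
      have := i.isLt
      simp only [l]
      omega)
    exact lt_of_lt_of_le (not_le.mp hi) h
  obtain ⟨P, hP⟩ := hQ l (by simp only [l]; omega)
  have hdvd : (X : ℚ⟦X⟧) ^ n l ∣ zetaTerm k Q n := by
    refine dvd_trans ?_ (Finset.dvd_prod_of_mem _ (Finset.mem_univ l))
    rw [hP, map_mul, Polynomial.aeval_X, mul_assoc]
    exact dvd_mul_right _ _
  exact X_pow_dvd_iff.mp hdvd m hl

/-- The space `𝒵_{q,d}`: the `ℚ`-span of all `ζ_q(k;Q)` with `r ≥ 0`, `k_j ≥ 1`,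
`deg Q_j ≤ k_j - d` and `Q_r ∈ X ℚ[X]`. -/
noncomputable def Z (d : ℕ) : Submodule ℚ ℚ⟦X⟧ :=
  Submodule.span ℚ {f | ∃ (r : ℕ) (k : Fin r → ℕ) (Q : Fin r → Polynomial ℚ),
    (∀ j, 1 ≤ k j) ∧ (∀ j, (Q j).natDegree + d ≤ k j) ∧ LastDvd Q ∧ f = zeta k Q}

/-- The space `𝒵_{q,d}°`: the `ℚ`-span of all `ζ_q(k;Q)` with `r ≥ 0`, `k_j ≥ 1`,
`deg Q_j ≤ k_j - d` and `Q_j ∈ X ℚ[X]` for all `j`. -/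
noncomputable def Zcirc (d : ℕ) : Submodule ℚ ℚ⟦X⟧ :=
  Submodule.span ℚ {f | ∃ (r : ℕ) (k : Fin r → ℕ) (Q : Fin r → Polynomial ℚ),
    (∀ j, 1 ≤ k j) ∧ (∀ j, (Q j).natDegree + d ≤ k j) ∧ (∀ j, Polynomial.X ∣ Q j) ∧ f = zeta k Q}

end QMZV

/-!
The space `𝒵_{q,d}` is spanned by nested sums of the functions `(1 + t_n)^d t_n^k`, `k ≥ 0`, of
`t_n = q^n / (1 - q^n)`, the outermost exponent being positive, and `𝒵_{q,d}°` by those in which all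
exponents are positive. So the exponent `0` has to be eliminated.

To this end the sums are truncated at `N` and deformed. With noncommuting letters `a_0, …, a_m`, let
`L(t) = 1 + ∑_k (1 + t)^d t^k a_k` and `K(s) = (1 - s a_0)⁻¹`, and consider the ordered product
`P_N = ∏_{0 < n < N} K(t_{N-n}) L(t_n)`. As `N → ∞`, the coefficient in `P_N` of a word ending in a
letter other than `a_0` tends to the corresponding nested sum
(`X_pow_dvd_partProd_corner_sub`, `partProd_one_apply`), because `t_{N-n} t_{n'}` is divisible by
`q^N` for `n ≤ n'`.

Regrouping factors gives `P_{N+1} = K(t_N) (∏_{0 < n < N} L(t_n) K(t_{N-n})) L(t_N)`. The relation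
`t_a t_b = t_{a+b} (t_a + t_b + 1)` (`qfrac_mul_qfrac`) yields a substitution `a_k ↦ b_k`, depending
on `τ = t_N` but not on `n`, that turns each `K(t_{N-n}) L(t_n)` into `L(t_n) K(t_{N-n})`
(`exists_isSwap`, `IsSwap.swap`). Hence `P_{N+1}(a) = K(τ) P_N(b) L(τ)`. This operation preserves the
left ideal generated by `a_0` (`IsSwap.zero_mul_letterFactor`), so the coefficients of words
not ending in `a_0` satisfy a closed recursion in `N`. Its leading term is the identity, and the
other coefficients are polynomials in `τ` divisible by `τ (1 + τ)^d`: at `τ = 0` the substitution is the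
identity, and for `d = 1` at `τ = -1` it is the conjugation by `1 + a_0`
(`exists_wordVal_succ`). Summing over `N`, by induction on the length of the word, every such
coefficient is a linear combination of truncated sums of the type defining `𝒵_{q,d}°`
(`wordVal_mem_circSeq`), and the limit `N → ∞` gives the result.

Coefficients of words are handled through representations by strictly upper triangular matrices:
`letterMat w` sends the letters to matrices such that the upper right corner of a product of letters
is `1` for the word `w` and `0` for all others.
-/

namespace QMZV

/-! ### Sequences of truncated sums -/

/-- The power series `t_n = q^n / (1 - q^n)`. -/
noncomputable def qfrac (n : ℕ) : ℚ⟦X⟧ := X ^ n * (1 - X ^ n)⁻¹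

theorem one_sub_X_pow_mul_inv {n : ℕ} (hn : n ≠ 0) :
    (1 - (X : ℚ⟦X⟧) ^ n) * (1 - X ^ n)⁻¹ = 1 := by
  apply PowerSeries.mul_inv_cancel
  simp [hn]

theorem one_add_qfrac {n : ℕ} (hn : n ≠ 0) : 1 + qfrac n = (1 - X ^ n)⁻¹ := by
  rw [qfrac]
  linear_combination (-1 : ℚ⟦X⟧) * one_sub_X_pow_mul_inv hn

/-- The relation `t_a t_b = t_{a+b} (t_a + t_b + 1)`, the only property of the `t_n` on which the
recursion in the truncation parameter depends. -/
theorem qfrac_mul_qfrac {a b : ℕ} (ha : a ≠ 0) (hb : b ≠ 0) :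
    qfrac a * qfrac b = qfrac (a + b) * (qfrac a + qfrac b + 1) := by
  have hA := one_sub_X_pow_mul_inv ha
  have hB := one_sub_X_pow_mul_inv hb
  have hC := one_sub_X_pow_mul_inv (n := a + b) (by omega)
  simp only [qfrac]
  rw [pow_add] at hC ⊢
  generalize (1 - (X : ℚ⟦X⟧) ^ a)⁻¹ = A at *
  generalize (1 - (X : ℚ⟦X⟧) ^ b)⁻¹ = B at *
  generalize (1 - (X : ℚ⟦X⟧) ^ a * X ^ b)⁻¹ = C at *
  generalize (X : ℚ⟦X⟧) ^ a = x at *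
  generalize (X : ℚ⟦X⟧) ^ b = y at *
  linear_combination x * y * (-(A * B) * hC + C * B * hA + C * x * A * hB + C * hB)

/-- The operator `g ↦ (N ↦ ∑_{0 < n < N} h(t_n) g(n))` on sequences of power series. Truncated
multiple sums arise by iterating it. -/
noncomputable def sumOp : Polynomial ℚ →ₗ[ℚ] (ℕ → ℚ⟦X⟧) →ₗ[ℚ] (ℕ → ℚ⟦X⟧) :=
  LinearMap.mk₂ ℚ (fun h g N => ∑ n ∈ Finset.Ico 1 N, Polynomial.aeval (qfrac n) h * g n)
    (by intro h h' g; ext1 N; simp [add_mul, Finset.sum_add_distrib])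
    (by intro c h g; ext1 N; simp [Finset.smul_sum])
    (by intro h g g'; ext1 N; simp [mul_add, Finset.sum_add_distrib])
    (by intro c h g; ext1 N; simp [Finset.smul_sum])

theorem sumOp_apply (h : Polynomial ℚ) (g : ℕ → ℚ⟦X⟧) (N : ℕ) :
    sumOp h g N = ∑ n ∈ Finset.Ico 1 N, Polynomial.aeval (qfrac n) h * g n := rfl

/-- The truncation of `ζ_q(k;Q)` to `0 < n_1 < ⋯ < n_r < N`, as a sequence in `N`. -/
noncomputable def truncZeta {r : ℕ} (k : Fin r → ℕ) (Q : Fin r → Polynomial ℚ) (N : ℕ) : ℚ⟦X⟧ :=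
  open Classical in
  ∑ n ∈ (Fintype.piFinset fun _ : Fin r => Finset.range N) with n ∈ indexSet r, zetaTerm k Q n

theorem truncZeta_zero (k : Fin 0 → ℕ) (Q : Fin 0 → Polynomial ℚ) : truncZeta k Q = 1 := by
  classical
  ext1 N
  rw [truncZeta, Finset.filter_true_of_mem]
  · simp [zetaTerm]
  · intro n _
    exact ⟨fun i => i.elim0, fun i => i.elim0⟩

theorem snoc_mem_indexSet_iff {r : ℕ} (n : Fin r → ℕ) (a : ℕ) :
    (Fin.snoc n a : Fin (r + 1) → ℕ) ∈ indexSet (r + 1) ↔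
      n ∈ indexSet r ∧ (∀ j, n j < a) ∧ 0 < a := by
  constructor
  · rintro ⟨hm, hp⟩
    refine ⟨⟨fun i j hij => ?_, fun j => ?_⟩, fun j => ?_, ?_⟩
    · simpa using hm (Fin.castSucc_lt_castSucc_iff.mpr hij)
    · simpa using hp j.castSucc
    · simpa using hm (Fin.castSucc_lt_last j)
    · simpa using hp (Fin.last r)
  · rintro ⟨⟨hm, hp⟩, hlt, ha⟩
    refine ⟨fun i j => ?_, fun j => ?_⟩
    · refine Fin.lastCases ?_ (fun j => ?_) j
      · refine Fin.lastCases ?_ (fun i => ?_) i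
        · intro h; exact absurd h (lt_irrefl _)
        · intro _; simpa using hlt i
      · refine Fin.lastCases ?_ (fun i => ?_) i
        · intro h; exact absurd h (not_lt.mpr (Fin.le_last _))
        · intro h; simpa using hm (Fin.castSucc_lt_castSucc_iff.mp h)
    · refine Fin.lastCases ?_ (fun j => ?_) j
      · simpa using ha
      · simpa using hp j

theorem zetaTerm_snoc {r : ℕ} (k : Fin r → ℕ) (Q : Fin r → Polynomial ℚ) (n : Fin r → ℕ)
    (k' : ℕ) (Q' : Polynomial ℚ) (a : ℕ) :
    zetaTerm (Fin.snoc k k' : Fin (r + 1) → ℕ) (Fin.snoc Q Q' : Fin (r + 1) → Polynomial ℚ)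
      (Fin.snoc n a : Fin (r + 1) → ℕ) =
      Polynomial.aeval ((X : ℚ⟦X⟧) ^ a) Q' * ((1 - (X : ℚ⟦X⟧) ^ a) ^ k')⁻¹ * zetaTerm k Q n := by
  simp only [zetaTerm, Fin.prod_univ_castSucc, Fin.snoc_castSucc, Fin.snoc_last]
  ring

theorem truncZeta_snoc {r : ℕ} (k : Fin r → ℕ) (Q : Fin r → Polynomial ℚ)
    (k' : ℕ) (Q' : Polynomial ℚ) (N : ℕ) :
    truncZeta (Fin.snoc k k' : Fin (r + 1) → ℕ) (Fin.snoc Q Q' : Fin (r + 1) → Polynomial ℚ) N =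
      ∑ a ∈ Finset.Ico 1 N, Polynomial.aeval ((X : ℚ⟦X⟧) ^ a) Q' *
        ((1 - (X : ℚ⟦X⟧) ^ a) ^ k')⁻¹ * truncZeta k Q a := by
  classical
  simp only [truncZeta, Finset.mul_sum]
  rw [Finset.sum_sigma']
  symm
  refine Finset.sum_bij (fun p _ => (Fin.snoc p.2 p.1 : Fin (r + 1) → ℕ)) ?_ ?_ ?_ ?_
  · rintro ⟨a, n⟩ h
    simp only [Finset.mem_sigma, Finset.mem_Ico, Finset.mem_filter, Fintype.mem_piFinset,
      Finset.mem_range] at h ⊢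
    refine ⟨fun j => ?_, (snoc_mem_indexSet_iff _ _).mpr ⟨h.2.2, h.2.1, h.1.1⟩⟩
    refine Fin.lastCases ?_ (fun j => ?_) j
    · simpa using h.1.2
    · simpa using (h.2.1 j).trans h.1.2
  · rintro ⟨a, n⟩ _ ⟨a', n'⟩ _ h
    obtain ⟨h1, h2⟩ := Fin.snoc_injective2 h
    simp only at h1 h2
    subst h1 h2
    rfl
  · intro n h
    simp only [Finset.mem_filter, Fintype.mem_piFinset, Finset.mem_range] at h
    have hs : (Fin.snoc (Fin.init n) (n (Fin.last r)) : Fin (r + 1) → ℕ) = n := Fin.snoc_init_self n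
    have h2 := h.2
    rw [← hs, snoc_mem_indexSet_iff] at h2
    refine ⟨⟨n (Fin.last r), Fin.init n⟩, ?_, hs⟩
    simp only [Finset.mem_sigma, Finset.mem_Ico, Finset.mem_filter, Fintype.mem_piFinset,
      Finset.mem_range]
    exact ⟨⟨h2.2.2, h.1 _⟩, h2.2.1, h2.1⟩
  · rintro ⟨a, n⟩ _
    exact (zetaTerm_snoc _ _ _ _ _ _).symm

theorem coeff_zeta {r : ℕ} {k : Fin r → ℕ} {Q : Fin r → Polynomial ℚ} (hQ : LastDvd Q)
    {m N : ℕ} (h : m < N) : coeff m (zeta k Q) = coeff m (truncZeta k Q N) := by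
  classical
  rw [zeta, coeff_mk, truncZeta, map_sum]
  apply finsum_mem_eq_sum_of_inter_support_eq
  ext n
  simp only [Set.mem_inter_iff, Function.mem_support, Finset.coe_filter, Fintype.mem_piFinset,
    Finset.mem_range, Set.mem_ofPred_eq]
  refine ⟨fun ⟨h1, h2⟩ => ⟨⟨fun i => lt_of_le_of_lt ?_ h, h1⟩, h2⟩, fun ⟨h1, h2⟩ => ⟨h1.2, h2⟩⟩
  by_contra hi
  apply h2
  have hl : m < n ⟨r - 1, by have := i.pos; omega⟩ := by
    refine lt_of_lt_of_le (not_le.mp hi) (h1.1.monotone ?_)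
    rw [Fin.le_def]
    have := i.isLt
    simp only
    omega
  obtain ⟨P, hP⟩ := hQ ⟨r - 1, by have := i.pos; omega⟩ (by have := i.pos; simp only; omega)
  refine X_pow_dvd_iff.mp (dvd_trans ?_ (Finset.dvd_prod_of_mem _ (Finset.mem_univ
    (⟨r - 1, by have := i.pos; omega⟩ : Fin r)))) m hl
  rw [hP, map_mul, Polynomial.aeval_X, mul_assoc]
  exact dvd_mul_right _ _

/-- The formal limit of a sequence `g` of power series for which `g N` stabilises modulo `q^N`:
the `m`-th coefficient is read off from `g (m + 1)`. -/
noncomputable def limSeq : (ℕ → ℚ⟦X⟧) →ₗ[ℚ] ℚ⟦X⟧ where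
  toFun g := PowerSeries.mk fun m => coeff m (g (m + 1))
  map_add' g g' := by ext; simp
  map_smul' c g := by ext; simp

theorem limSeq_truncZeta {r : ℕ} {k : Fin r → ℕ} {Q : Fin r → Polynomial ℚ} (hQ : LastDvd Q) :
    limSeq (truncZeta k Q) = zeta k Q := by
  ext m
  rw [coeff_zeta hQ (Nat.lt_succ_self m)]
  simp [limSeq]

theorem limSeq_congr {g g' : ℕ → ℚ⟦X⟧} (h : ∀ N, 1 ≤ N → X ^ N ∣ g N - g' N) :
    limSeq g = limSeq g' := by
  ext m
  have := X_pow_dvd_iff.mp (h (m + 1) (by omega)) m (by omega)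
  simpa [limSeq, sub_eq_zero] using this

/-- Substituting `x = t / (1 + t)` turns `x^i / (1 - x)^k` with `i ≤ k` into `t^i (1 + t)^(k-i)`. -/
noncomputable def toQfrac (k : ℕ) (Q : Polynomial ℚ) : Polynomial ℚ :=
  ∑ i ∈ Finset.range (Q.natDegree + 1),
    Polynomial.C (Q.coeff i) * (Polynomial.X ^ i * (1 + Polynomial.X) ^ (k - i))

theorem aeval_toQfrac {k : ℕ} {Q : Polynomial ℚ} (hQ : Q.natDegree ≤ k) {n : ℕ} (hn : n ≠ 0) :
    Polynomial.aeval (qfrac n) (toQfrac k Q) =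
      Polynomial.aeval ((X : ℚ⟦X⟧) ^ n) Q * ((1 - (X : ℚ⟦X⟧) ^ n) ^ k)⁻¹ := by
  have hinv : ∀ j, ((1 - (X : ℚ⟦X⟧) ^ n) ^ j)⁻¹ = (1 + qfrac n) ^ j := by
    intro j
    rw [one_add_qfrac hn, PowerSeries.inv_eq_iff_mul_eq_one (by simp [hn]), ← mul_pow, mul_comm,
      one_sub_X_pow_mul_inv hn, one_pow]
  conv_rhs => rw [Polynomial.aeval_eq_sum_range, Finset.sum_mul]
  rw [toQfrac, map_sum]
  refine Finset.sum_congr rfl fun i hi => ?_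
  have hik : i ≤ k := by have := Finset.mem_range.mp hi; omega
  simp only [map_mul, map_pow, map_add, map_one, Polynomial.aeval_X, Polynomial.aeval_C]
  rw [hinv, ← Nat.add_sub_cancel' hik, pow_add, Nat.add_sub_cancel_left, Algebra.smul_def]
  have : qfrac n ^ i = (X ^ n) ^ i * (1 + qfrac n) ^ i := by
    rw [one_add_qfrac hn, qfrac, mul_pow]
  rw [this]
  ring

theorem truncZeta_snoc_eq_sumOp {r : ℕ} (k : Fin r → ℕ) (Q : Fin r → Polynomial ℚ)
    {k' : ℕ} {Q' : Polynomial ℚ} (hQ' : Q'.natDegree ≤ k') :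
    truncZeta (Fin.snoc k k' : Fin (r + 1) → ℕ) (Fin.snoc Q Q' : Fin (r + 1) → Polynomial ℚ) =
      sumOp (toQfrac k' Q') (truncZeta k Q) := by
  ext1 N
  rw [truncZeta_snoc, sumOp_apply]
  refine Finset.sum_congr rfl fun a ha => ?_
  rw [aeval_toQfrac hQ' (by have := Finset.mem_Ico.mp ha; omega)]

theorem dvd_toQfrac {d k : ℕ} {Q : Polynomial ℚ} (hQ : Q.natDegree + d ≤ k) :
    (1 + Polynomial.X) ^ d ∣ toQfrac k Q := by
  refine Finset.dvd_sum fun i hi => ?_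
  refine Dvd.dvd.mul_left (Dvd.dvd.mul_left (pow_dvd_pow _ ?_) _) _
  have := Finset.mem_range.mp hi
  omega

theorem X_mul_dvd_toQfrac {d k : ℕ} {Q : Polynomial ℚ} (hQ : Q.natDegree + d ≤ k)
    (hX : Polynomial.X ∣ Q) :
    Polynomial.X * (1 + Polynomial.X) ^ d ∣ toQfrac k Q := by
  refine Finset.dvd_sum fun i hi => ?_
  rcases Nat.eq_zero_or_pos i with rfl | hi0
  · rw [Polynomial.X_dvd_iff.mp hX]
    simp
  · refine Dvd.dvd.mul_left (mul_dvd_mul (dvd_pow_self _ hi0.ne') (pow_dvd_pow _ ?_)) _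
    have := Finset.mem_range.mp hi
    omega

/-- The span of the truncations of the generators of `𝒵_{q,d}°`. -/
noncomputable def circSeq (d : ℕ) : Submodule ℚ (ℕ → ℚ⟦X⟧) :=
  Submodule.span ℚ {g | ∃ (r : ℕ) (k : Fin r → ℕ) (Q : Fin r → Polynomial ℚ),
    (∀ j, 1 ≤ k j) ∧ (∀ j, (Q j).natDegree + d ≤ k j) ∧ (∀ j, Polynomial.X ∣ Q j) ∧
      g = truncZeta k Q}

theorem limSeq_mem_Zcirc {d : ℕ} {g : ℕ → ℚ⟦X⟧} (hg : g ∈ circSeq d) : limSeq g ∈ Zcirc d := by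
  suffices h : circSeq d ≤ (Zcirc d).comap limSeq from h hg
  refine Submodule.span_le.mpr ?_
  rintro _ ⟨r, k, Q, h1, h2, h3, rfl⟩
  rw [SetLike.mem_coe, Submodule.mem_comap, limSeq_truncZeta fun j _ => h3 j]
  exact Submodule.subset_span ⟨r, k, Q, h1, h2, h3, rfl⟩

theorem one_mem_circSeq (d : ℕ) : (1 : ℕ → ℚ⟦X⟧) ∈ circSeq d :=
  Submodule.subset_span ⟨0, fun i => i.elim0, fun i => i.elim0, fun i => i.elim0,
    fun i => i.elim0, fun i => i.elim0, (truncZeta_zero _ _).symm⟩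

theorem sumOp_mem_circSeq {d : ℕ} {h : Polynomial ℚ}
    (hh : Polynomial.X * (1 + Polynomial.X) ^ d ∣ h) {g : ℕ → ℚ⟦X⟧} (hg : g ∈ circSeq d) :
    sumOp h g ∈ circSeq d := by
  obtain ⟨p, rfl⟩ := hh
  induction p using Polynomial.induction_on' with
  | add p p' hp hp' =>
    rw [mul_add, map_add, LinearMap.add_apply]
    exact Submodule.add_mem _ hp hp'
  | monomial j c =>
    suffices hs : circSeq d ≤ (circSeq d).comap
        (sumOp (Polynomial.X * (1 + Polynomial.X) ^ d * Polynomial.monomial j c)) from hs hg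
    refine Submodule.span_le.mpr ?_
    rintro _ ⟨r, k, Q, h1, h2, h3, rfl⟩
    have hdeg : (Polynomial.C c * Polynomial.X ^ (j + 1)).natDegree ≤ j + 1 :=
      Polynomial.natDegree_C_mul_X_pow_le _ _
    have hop : sumOp (Polynomial.X * (1 + Polynomial.X) ^ d * Polynomial.monomial j c) =
        sumOp (toQfrac (j + 1 + d) (Polynomial.C c * Polynomial.X ^ (j + 1))) := by
      ext1 g
      ext1 N
      rw [sumOp_apply, sumOp_apply]
      refine Finset.sum_congr rfl fun n hn => ?_
      have hn : n ≠ 0 := by have := Finset.mem_Ico.mp hn; omega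
      rw [aeval_toQfrac (by omega) hn, PowerSeries.inv_eq_iff_mul_eq_one (by simp [hn]) |>.mpr
        (show (1 + qfrac n) ^ (j + 1 + d) * (1 - X ^ n) ^ (j + 1 + d) = 1 by
          rw [one_add_qfrac hn, ← mul_pow, mul_comm, one_sub_X_pow_mul_inv hn, one_pow])]
      have hq : qfrac n = X ^ n * (1 + qfrac n) := by rw [one_add_qfrac hn, qfrac]
      have hq' : qfrac n ^ (j + 1) = (X ^ n) ^ (j + 1) * (1 + qfrac n) ^ (j + 1) := by
        rw [← mul_pow, ← hq]
      rw [← Polynomial.C_mul_X_pow_eq_monomial]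
      simp only [map_mul, map_pow, map_add, map_one, Polynomial.aeval_X, Polynomial.aeval_C]
      linear_combination (1 + qfrac n) ^ d * (algebraMap ℚ ℚ⟦X⟧) c * g n * hq'
    rw [SetLike.mem_coe, Submodule.mem_comap, hop, ← truncZeta_snoc_eq_sumOp _ _ (by omega)]
    refine Submodule.subset_span ⟨r + 1, _, _, ?_, ?_, ?_, rfl⟩
    · refine Fin.lastCases (by simp; omega) (fun i => by simpa using h1 i)
    · refine Fin.lastCases (by simpa using hdeg) (fun i => by simpa using h2 i)
    · refine Fin.lastCases ?_ (fun i => by simpa using h3 i)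
      simp only [Fin.snoc_last]
      exact Dvd.dvd.mul_left (dvd_pow_self _ (by omega)) _

/-! ### Ordered products with two kinds of factors -/

section Factors

variable {S Λ Λ' : Type*} [CommRing S] [Ring Λ] [Algebra S Λ] [Ring Λ'] [Algebra S Λ']

/-- The geometric series `∑_{j<D} s^j b_0^j`; it is the inverse of `1 - s b_0` when
`b_0 ^ D = 0`. -/
def geomFactor (D : ℕ) (s : S) (b : ℕ → Λ) : Λ :=
  ∑ j ∈ Finset.range D, (s • b 0) ^ j

/-- The factor `1 + ∑_{k≤m} (1+t)^d t^k b_k`. -/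
def letterFactor (d m : ℕ) (t : S) (b : ℕ → Λ) : Λ :=
  1 + ∑ k ∈ Finset.range (m + 1), ((1 + t) ^ d * t ^ k) • b k

/-- The ordered product over `1 ≤ i ≤ n` of `geomFactor` at `t_{N-i}` and `letterFactor` at
`t_i`. -/
def partProd (d m D : ℕ) (t : ℕ → S) (N : ℕ) (b : ℕ → Λ) : ℕ → Λ
  | 0 => 1
  | n + 1 => partProd d m D t N b n * geomFactor D (t (N - (n + 1))) b *
      letterFactor d m (t (n + 1)) b

theorem map_geomFactor (φ : Λ →ₐ[S] Λ') (D : ℕ) (s : S) (b : ℕ → Λ) :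
    φ (geomFactor D s b) = geomFactor D s fun k => φ (b k) := by
  simp [geomFactor]

theorem map_letterFactor (φ : Λ →ₐ[S] Λ') (d m : ℕ) (t : S) (b : ℕ → Λ) :
    φ (letterFactor d m t b) = letterFactor d m t fun k => φ (b k) := by
  simp [letterFactor]

theorem map_partProd (φ : Λ →ₐ[S] Λ') (d m D : ℕ) (t : ℕ → S) (N : ℕ) (b : ℕ → Λ) (n : ℕ) :
    φ (partProd d m D t N b n) = partProd d m D t N (fun k => φ (b k)) n := by
  induction n with
  | zero => simp [partProd]
  | succ n ih => simp only [partProd, map_mul, ih, map_geomFactor, map_letterFactor]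

theorem letterFactor_congr {d m : ℕ} {t : S} {b b' : ℕ → Λ} (h : ∀ k ≤ m, b k = b' k) :
    letterFactor d m t b = letterFactor d m t b' := by
  rw [letterFactor, letterFactor]
  congr 1
  refine Finset.sum_congr rfl fun k hk => ?_
  rw [h k (by have := Finset.mem_range.mp hk; omega)]

theorem partProd_congr {d m D : ℕ} {t : ℕ → S} {N : ℕ} {b b' : ℕ → Λ}
    (h : ∀ k ≤ m, b k = b' k) (n : ℕ) :
    partProd d m D t N b n = partProd d m D t N b' n := by
  induction n with
  | zero => rfl
  | succ n ih =>
    simp only [partProd, ih, letterFactor_congr h, geomFactor, h 0 (Nat.zero_le m)]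

theorem geomFactor_mul {D : ℕ} {b : ℕ → Λ} (hb : b 0 ^ D = 0) (s : S) :
    geomFactor D s b * (1 - s • b 0) = 1 := by
  rw [geomFactor, geom_sum_mul_neg, smul_pow, hb, smul_zero, sub_zero]

theorem mul_geomFactor {D : ℕ} {b : ℕ → Λ} (hb : b 0 ^ D = 0) (s : S) :
    (1 - s • b 0) * geomFactor D s b = 1 := by
  rw [geomFactor, mul_neg_geom_sum, smul_pow, hb, smul_zero, sub_zero]

/-- Passing from the truncation parameter `N` to `N + 1`: the factors of the product for `N + 1` are
regrouped in pairs in the opposite order, and the substitution of `b` for `a` restores the order of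
each pair. -/
theorem geomFactor_mul_partProd_mul_letterFactor {d m D : ℕ} {t : ℕ → S} {N : ℕ} {a b : ℕ → Λ}
    (hswap : ∀ n, 0 < n → n < N →
      geomFactor D (t (N - n)) b * letterFactor d m (t n) b =
        letterFactor d m (t n) a * geomFactor D (t (N - n)) a) {n : ℕ} (hn : n < N) :
    geomFactor D (t N) a * partProd d m D t N b n * letterFactor d m (t (n + 1)) a =
      partProd d m D t (N + 1) a (n + 1) := by
  induction n with
  | zero => simp [partProd]
  | succ n ih =>
    have h1 : partProd d m D t (N + 1) a (n + 1 + 1) = partProd d m D t (N + 1) a (n + 1) *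
        geomFactor D (t (N - (n + 1))) a * letterFactor d m (t (n + 1 + 1)) a := by
      rw [partProd, show N + 1 - (n + 1 + 1) = N - (n + 1) by omega]
    rw [h1, ← ih (by omega), partProd, mul_assoc (partProd d m D t N b n),
      hswap (n + 1) (by omega) hn]
    simp only [mul_assoc]

/-- The relations between `a` and `b` under which `b` is the substitution that interchanges the two
kinds of factors, at parameter `τ`. The auxiliary `U k` is
`∑_{j>k} τ^(j-1-k) (b_j a_0 - b_0 a_j)`, given by its recursion. -/
structure IsSwap (d m : ℕ) (τ : S) (a b U : ℕ → Λ) : Prop where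
  top : U m = 0
  step : ∀ k < m, U k = (b (k + 1) * a 0 - b 0 * a (k + 1)) + τ • U (k + 1)
  zero : b 0 = a 0 + (τ * (1 + τ) ^ d) • U 0
  succ : ∀ k < m, b (k + 1) = a (k + 1) + τ • (U (k + 1) + U k)

theorem IsSwap.map {S₁ Λ₁ : Type*} [CommRing S₁] [Ring Λ₁] [Algebra S₁ Λ₁] {d m : ℕ} {τ : S}
    {a b U : ℕ → Λ} (h : IsSwap d m τ a b U) (f : S →+* S₁) (φ : Λ →+* Λ₁)
    (hφ : ∀ s x, φ (s • x) = f s • φ x) :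
    IsSwap d m (f τ) (fun k => φ (a k)) (fun k => φ (b k)) (fun k => φ (U k)) where
  top := by simp [h.top]
  step k hk := by rw [h.step k hk]; simp [hφ]
  zero := by rw [h.zero]; simp [hφ]
  succ k hk := by rw [h.succ k hk]; simp [hφ]

variable {d m : ℕ} {τ : S} {a b U : ℕ → Λ}

theorem sum_pow_succ_smul (T : S) (U : ℕ → Λ) (m : ℕ) :
    ∑ k ∈ Finset.range m, T ^ (k + 1) • U (k + 1) =
      ∑ k ∈ Finset.range (m + 1), T ^ k • U k - U 0 := by
  rw [Finset.sum_range_succ']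
  simp

theorem IsSwap.sum_sub (h : IsSwap d m τ a b U) (T : S) :
    ∑ k ∈ Finset.range (m + 1), T ^ k • (b k - a k) =
      (τ * (1 + τ) ^ d - τ) • U 0 +
        (τ * (1 + T)) • ∑ k ∈ Finset.range (m + 1), T ^ k • U k := by
  have h1 : ∑ k ∈ Finset.range m, T ^ (k + 1) • (b (k + 1) - a (k + 1)) =
      τ • ∑ k ∈ Finset.range m, T ^ (k + 1) • U (k + 1) +
        (τ * T) • ∑ k ∈ Finset.range m, T ^ k • U k := by
    rw [Finset.smul_sum, Finset.smul_sum, ← Finset.sum_add_distrib]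
    refine Finset.sum_congr rfl fun k hk => ?_
    rw [h.succ k (Finset.mem_range.mp hk)]
    module
  have h2 : ∑ k ∈ Finset.range m, T ^ k • U k = ∑ k ∈ Finset.range (m + 1), T ^ k • U k := by
    rw [Finset.sum_range_succ, h.top]
    simp
  rw [Finset.sum_range_succ', h1, h2, sum_pow_succ_smul, h.zero]
  module

theorem IsSwap.sum_comm (h : IsSwap d m τ a b U) (T : S) :
    ∑ k ∈ Finset.range (m + 1), T ^ k • (b k * a 0 - b 0 * a k) =
      τ • U 0 + (T - τ) • ∑ k ∈ Finset.range (m + 1), T ^ k • U k := by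
  have h1 : ∑ k ∈ Finset.range m, T ^ (k + 1) • (b (k + 1) * a 0 - b 0 * a (k + 1)) =
      T • ∑ k ∈ Finset.range m, T ^ k • U k -
        τ • ∑ k ∈ Finset.range m, T ^ (k + 1) • U (k + 1) := by
    rw [Finset.smul_sum, Finset.smul_sum, ← Finset.sum_sub_distrib]
    refine Finset.sum_congr rfl fun k hk => ?_
    rw [h.step k (Finset.mem_range.mp hk)]
    module
  have h2 : ∑ k ∈ Finset.range m, T ^ k • U k = ∑ k ∈ Finset.range (m + 1), T ^ k • U k := by
    rw [Finset.sum_range_succ, h.top]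
    simp
  rw [Finset.sum_range_succ', h1, h2, sum_pow_succ_smul]
  simp only [sub_self, smul_zero, add_zero]
  module

theorem letterFactor_eq (d m : ℕ) (T : S) (c : ℕ → Λ) :
    letterFactor d m T c = 1 + (1 + T) ^ d • ∑ k ∈ Finset.range (m + 1), T ^ k • c k := by
  simp only [letterFactor, Finset.smul_sum, smul_smul]

theorem mul_letterFactor_sub (d m : ℕ) (T : S) (a b : ℕ → Λ) :
    b 0 * letterFactor d m T a - letterFactor d m T b * a 0 =
      b 0 - a 0 - (1 + T) ^ d •
        ∑ k ∈ Finset.range (m + 1), T ^ k • (b k * a 0 - b 0 * a k) := by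
  simp only [letterFactor_eq, mul_add, add_mul, mul_one, one_mul, smul_mul_assoc, mul_smul_comm,
    Finset.mul_sum, Finset.sum_mul, smul_sub, Finset.sum_sub_distrib]
  abel

theorem IsSwap.zero_mul_letterFactor (h : IsSwap d m τ a b U) :
    b 0 * letterFactor d m τ a = letterFactor d m τ b * a 0 := by
  rw [← sub_eq_zero, mul_letterFactor_sub, h.sum_comm, h.zero]
  module

theorem IsSwap.one_sub_mul_letterFactor (h : IsSwap d m τ a b U) (hd : d ≤ 1) {s T : S}
    (hsT : s * T = τ * (s + T + 1)) :
    (1 - s • b 0) * letterFactor d m T a = letterFactor d m T b * (1 - s • a 0) := by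
  have h1 : (1 - s • b 0) * letterFactor d m T a - letterFactor d m T b * (1 - s • a 0) =
      (letterFactor d m T a - letterFactor d m T b) -
        s • (b 0 * letterFactor d m T a - letterFactor d m T b * a 0) := by
    simp only [sub_mul, mul_sub, one_mul, mul_one, smul_mul_assoc, mul_smul_comm, smul_sub]
    abel
  have h2 : letterFactor d m T a - letterFactor d m T b =
      -((1 + T) ^ d • ∑ k ∈ Finset.range (m + 1), T ^ k • (b k - a k)) := by
    simp only [letterFactor_eq, smul_sub, Finset.sum_sub_distrib]
    abel
  rw [← sub_eq_zero, h1, h2, mul_letterFactor_sub, h.sum_comm, h.sum_sub, h.zero]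
  generalize ∑ k ∈ Finset.range (m + 1), T ^ k • U k = V
  have hV : τ * (1 + T) - s * (T - τ) = 0 := by linear_combination -hsT
  have hU : (1 + T) ^ d * (τ * (1 + τ) ^ d - τ - s * τ) + s * (τ * (1 + τ) ^ d) = 0 := by
    interval_cases d
    · ring
    · linear_combination -τ * hsT
  have h3 : ∀ x y : S, x = 0 → y = 0 → x • U 0 + y • V = 0 := by
    rintro x y rfl rfl
    simp
  rw [← h3 _ _ (neg_eq_zero.mpr hU)
    (show -((1 + T) ^ d * (τ * (1 + T) - s * (T - τ))) = 0 by rw [hV]; simp)]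
  module

theorem IsSwap.swap (h : IsSwap d m τ a b U) (hd : d ≤ 1) {D : ℕ} (ha : a 0 ^ D = 0)
    (hb : b 0 ^ D = 0) {s T : S} (hsT : s * T = τ * (s + T + 1)) :
    geomFactor D s b * letterFactor d m T b = letterFactor d m T a * geomFactor D s a := by
  calc geomFactor D s b * letterFactor d m T b
      = geomFactor D s b * (letterFactor d m T b * (1 - s • a 0)) * geomFactor D s a := by
        rw [mul_assoc, mul_assoc, mul_geomFactor ha, mul_one]
    _ = letterFactor d m T a * geomFactor D s a := by
        rw [← h.one_sub_mul_letterFactor hd hsT, ← mul_assoc, geomFactor_mul hb, one_mul]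

end Factors

/-! ### Expansion in words -/

section Words

variable {S Λ : Type*} [CommRing S] [Ring Λ] [Algebra S Λ] (d m D : ℕ) (t : ℕ → S) (N : ℕ)

/-- The product `partProd` in the free algebra on letters `0, …, m`. -/
noncomputable def freeProd (n : ℕ) : MonoidAlgebra S (FreeMonoid (Fin (m + 1))) :=
  partProd d m D t N
    (fun k => if h : k < m + 1 then MonoidAlgebra.of S _ (FreeMonoid.of ⟨k, h⟩) else 0) n

theorem partProd_eq_sum (b : ℕ → Λ) (n : ℕ) :
    partProd d m D t N b n = (freeProd d m D t N n).coeff.sum fun v c =>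
      c • (v.toList.map fun i : Fin (m + 1) => b i).prod := by
  have h := MonoidAlgebra.lift_apply (R := S)
    (FreeMonoid.lift fun i : Fin (m + 1) => b i) (freeProd d m D t N n)
  simp only [FreeMonoid.lift_apply] at h
  rw [← h, freeProd, map_partProd]
  refine partProd_congr (fun k hk => ?_) n
  have hk' : k < m + 1 := by omega
  rw [dif_pos hk', MonoidAlgebra.lift_of]
  simp

end Words

/-! ### Words as paths in triangular matrices -/

section Matrices

variable {S S' : Type*} [CommRing S] [CommRing S']

/-- The matrix representing the letter `k` in the word `w`: its entries are `1` at the places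
`(p, p + 1)` such that the `p`-th letter of `w` is `k`. Hence the only word of length `w.length`
with nonzero entry in the upper right corner is `w` itself. -/
def letterMat (S : Type*) [CommRing S] (w : List ℕ) (k : ℕ) :
    Matrix (Fin (w.length + 1)) (Fin (w.length + 1)) S :=
  Matrix.of fun p q => if (q : ℕ) = p + 1 ∧ w[(p : ℕ)]? = some k then 1 else 0

theorem letterMat_map (f : S →+* S') (w : List ℕ) (k : ℕ) :
    f.mapMatrix (letterMat S w k) = letterMat S' w k := by
  ext p q
  simp [letterMat, apply_ite f]

theorem letterMat_mul_apply (w : List ℕ) (k : ℕ)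
    (M : Matrix (Fin (w.length + 1)) (Fin (w.length + 1)) S) (p q : Fin (w.length + 1)) :
    (letterMat S w k * M) p q =
      if h : (p : ℕ) + 1 < w.length + 1 then
        if w[(p : ℕ)]? = some k then M ⟨p + 1, h⟩ q else 0 else 0 := by
  rw [Matrix.mul_apply]
  split_ifs with h h'
  · rw [Finset.sum_eq_single ⟨p + 1, h⟩]
    · simp [letterMat, h']
    · intro r _ hr
      have : ¬ ((r : ℕ) = p + 1) := fun h' => hr (Fin.ext h')
      simp [letterMat, this]
    · simp
  · exact Finset.sum_eq_zero fun r _ => by simp [letterMat, h']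
  · exact Finset.sum_eq_zero fun r _ => by
      have : ¬ ((r : ℕ) = p + 1) := fun h' => h (h' ▸ r.isLt)
      simp [letterMat, this]

theorem mul_letterMat_apply_zero (w : List ℕ) (k : ℕ)
    (M : Matrix (Fin (w.length + 1)) (Fin (w.length + 1)) S) (p q : Fin (w.length + 1))
    (hq : (q : ℕ) = 0) : (M * letterMat S w k) p q = 0 := by
  rw [Matrix.mul_apply]
  exact Finset.sum_eq_zero fun r _ => by simp [letterMat, hq]

theorem mul_letterMat_apply_succ (w : List ℕ) (k : ℕ)
    (M : Matrix (Fin (w.length + 1)) (Fin (w.length + 1)) S) (p r q : Fin (w.length + 1))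
    (hq : (q : ℕ) = r + 1) :
    (M * letterMat S w k) p q = if w[(r : ℕ)]? = some k then M p r else 0 := by
  rw [Matrix.mul_apply, Finset.sum_eq_single r]
  · simp [letterMat, hq]
  · intro r' _ hr
    have : ¬ ((r : ℕ) = r') := fun h' => hr (Fin.ext h'.symm)
    simp [letterMat, hq, this]
  · simp

theorem prod_letterMat_apply (w v : List ℕ) (p q : Fin (w.length + 1)) :
    (v.map (letterMat S w)).prod p q =
      if (q : ℕ) = p + v.length ∧ v <+: w.drop p then 1 else 0 := by
  induction v generalizing p with
  | nil => simp [Matrix.one_apply, Fin.ext_iff, eq_comm]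
  | cons k v ih =>
    rw [List.map_cons, List.prod_cons, letterMat_mul_apply]
    by_cases hp : (p : ℕ) < w.length
    · rw [dif_pos (by omega), List.drop_eq_getElem_cons hp, List.getElem?_eq_getElem hp, ih]
      simp only [List.cons_prefix_cons, Option.some.injEq, List.length_cons]
      by_cases hk : w[(p : ℕ)] = k
      · simp [hk, add_assoc, add_comm 1]
      · simp [hk, Ne.symm hk]
    · rw [dif_neg (by omega), List.drop_eq_nil_of_le (by omega)]
      simp

theorem prod_letterMat_corner (w v : List ℕ) :
    (v.map (letterMat S w)).prod 0 (Fin.last _) = if v = w then 1 else 0 := by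
  rw [prod_letterMat_apply]
  congr 1
  simp only [Fin.val_last, Fin.val_zero, zero_add, List.drop_zero, eq_iff_iff]
  constructor
  · rintro ⟨h1, h2⟩
    exact h2.eq_of_length h1.symm
  · rintro rfl
    exact ⟨rfl, List.prefix_refl _⟩

/-- The matrix `M` vanishes below the `j`-th superdiagonal. -/
def Above {n : ℕ} (j : ℕ) (M : Matrix (Fin n) (Fin n) S) : Prop :=
  ∀ p q : Fin n, (q : ℕ) < p + j → M p q = 0

namespace Above

variable {n i j : ℕ} {A B : Matrix (Fin n) (Fin n) S}

theorem of_zero (j : ℕ) : Above j (0 : Matrix (Fin n) (Fin n) S) := fun _ _ _ => rfl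

theorem one : Above 0 (1 : Matrix (Fin n) (Fin n) S) := fun p q h => by
  rw [Matrix.one_apply_ne]
  rintro rfl
  omega

theorem add (hA : Above j A) (hB : Above j B) : Above j (A + B) := fun p q h => by
  rw [Matrix.add_apply, hA p q h, hB p q h, add_zero]

theorem sub (hA : Above j A) (hB : Above j B) : Above j (A - B) := fun p q h => by
  rw [Matrix.sub_apply, hA p q h, hB p q h, sub_zero]

theorem smul (s : S) (hA : Above j A) : Above j (s • A) := fun p q h => by
  rw [Matrix.smul_apply, hA p q h, smul_zero]

theorem mono (hij : i ≤ j) (hA : Above j A) : Above i A := fun p q h => hA p q (by omega)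

theorem mul (hA : Above i A) (hB : Above j B) : Above (i + j) (A * B) := fun p q h => by
  rw [Matrix.mul_apply]
  refine Finset.sum_eq_zero fun r _ => ?_
  by_cases hr : (r : ℕ) < p + i
  · rw [hA p r hr, zero_mul]
  · rw [hB r q (by omega), mul_zero]

theorem sum {ι : Type*} {s : Finset ι} {f : ι → Matrix (Fin n) (Fin n) S}
    (h : ∀ x ∈ s, Above j (f x)) : Above j (∑ x ∈ s, f x) := by
  classical
  induction s using Finset.induction_on with
  | empty => simpa using of_zero j
  | insert x s hx ih =>
    rw [Finset.sum_insert hx]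
    exact (h x (by simp)).add (ih fun y hy => h y (by simp [hy]))

theorem list_prod {ι : Type*} {f : ι → Matrix (Fin n) (Fin n) S} (h : ∀ x, Above 1 (f x))
    (l : List ι) : Above l.length (l.map f).prod := by
  induction l with
  | nil => exact one
  | cons x l ih =>
    rw [List.map_cons, List.prod_cons, List.length_cons, add_comm]
    exact (h x).mul ih

theorem list_prod_sub {ι : Type*} {f g : ι → Matrix (Fin n) (Fin n) S} (hf : ∀ x, Above 1 (f x))
    (hg : ∀ x, Above 1 (g x)) (hfg : ∀ x, Above 2 (f x - g x)) (l : List ι) :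
    Above (l.length + 1) ((l.map f).prod - (l.map g).prod) := by
  induction l with
  | nil => simpa using of_zero 1
  | cons x l ih =>
    have h : ((x :: l).map f).prod - ((x :: l).map g).prod =
        (f x - g x) * (l.map f).prod + g x * ((l.map f).prod - (l.map g).prod) := by
      simp only [List.map_cons, List.prod_cons]
      noncomm_ring
    rw [h]
    refine (((hfg x).mul (list_prod hf l)).mono ?_).add (((hg x).mul ih).mono ?_) <;>
      simp only [List.length_cons] <;> omega

theorem pow (hA : Above 1 A) (k : ℕ) : Above k (A ^ k) := by
  induction k with
  | zero => simpa using one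
  | succ k ih => rw [pow_succ]; exact ih.mul hA

theorem eq_zero (hA : Above j A) (h : n ≤ j) : A = 0 := by
  ext p q
  exact hA p q (by omega)

end Above

theorem above_letterMat (w : List ℕ) (k : ℕ) : Above 1 (letterMat S w k) := fun p q h => by
  have : ¬ ((q : ℕ) = p + 1) := by omega
  simp [letterMat, this]

end Matrices

/-! ### The substitution interchanging the two kinds of factors -/

section Existence

variable {S : Type*} [CommRing S] {n : ℕ}

/-- The auxiliary elements `U` of `IsSwap` as a function of `b`. -/
def swapAux (m : ℕ) (τ : S) (a b : ℕ → Matrix (Fin n) (Fin n) S) (i : ℕ) :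
    Matrix (Fin n) (Fin n) S :=
  ∑ j ∈ Finset.Ico (i + 1) (m + 1), τ ^ (j - 1 - i) • (b j * a 0 - b 0 * a j)

/-- The map whose fixed points `b` satisfy `IsSwap`. -/
def swapStep (d m : ℕ) (τ : S) (a b : ℕ → Matrix (Fin n) (Fin n) S) :
    ℕ → Matrix (Fin n) (Fin n) S
  | 0 => a 0 + (τ * (1 + τ) ^ d) • swapAux m τ a b 0
  | k + 1 => a (k + 1) + τ • (swapAux m τ a b (k + 1) + swapAux m τ a b k)

variable {d m : ℕ} {τ : S} {a b b' : ℕ → Matrix (Fin n) (Fin n) S}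

theorem isSwap_of_swapStep_eq (h : swapStep d m τ a b = b) :
    IsSwap d m τ a b (swapAux m τ a b) where
  top := by simp [swapAux]
  step k hk := by
    rw [swapAux, Finset.sum_eq_sum_Ico_succ_bot (by omega), swapAux, Finset.smul_sum]
    congr 1
    · simp
    · refine Finset.sum_congr rfl fun j hj => ?_
      have := Finset.mem_Ico.mp hj
      rw [smul_smul, ← pow_succ', show j - 1 - (k + 1) + 1 = j - 1 - k by omega]
  zero := (congrFun h 0).symm
  succ k _ := (congrFun h (k + 1)).symm

theorem above_swapAux_sub (ha : ∀ k, Above 1 (a k)) {j : ℕ} (h : ∀ k, Above j (b k - b' k))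
    (i : ℕ) : Above (j + 1) (swapAux m τ a b i - swapAux m τ a b' i) := by
  rw [swapAux, swapAux, ← Finset.sum_sub_distrib]
  refine Above.sum fun k _ => ?_
  rw [show τ ^ (k - 1 - i) • (b k * a 0 - b 0 * a k) - τ ^ (k - 1 - i) • (b' k * a 0 - b' 0 * a k) =
    τ ^ (k - 1 - i) • ((b k - b' k) * a 0 - (b 0 - b' 0) * a k) by
      rw [← smul_sub]; congr 1; noncomm_ring]
  exact (((h k).mul (ha 0)).sub ((h 0).mul (ha k))).smul _

theorem above_swapStep_sub (ha : ∀ k, Above 1 (a k)) {j : ℕ} (h : ∀ k, Above j (b k - b' k))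
    (k : ℕ) : Above (j + 1) (swapStep d m τ a b k - swapStep d m τ a b' k) := by
  cases k with
  | zero =>
    rw [swapStep, swapStep, add_sub_add_left_eq_sub, ← smul_sub]
    exact (above_swapAux_sub ha h 0).smul _
  | succ k =>
    rw [swapStep, swapStep, add_sub_add_left_eq_sub, ← smul_sub, add_sub_add_comm]
    exact ((above_swapAux_sub ha h (k + 1)).add (above_swapAux_sub ha h k)).smul _

theorem swapStep_zero : swapStep d m τ a 0 = a := by
  have h : ∀ i, swapAux m τ a 0 i = 0 := fun i => by simp [swapAux]
  ext1 k
  cases k <;> simp [swapStep, h]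

/-- Since the letters are strictly upper triangular, iterating `swapStep` becomes stationary. -/
theorem exists_isSwap (d m : ℕ) (τ : S) (ha : ∀ k, Above 1 (a k)) :
    ∃ b U, IsSwap d m τ a b U ∧ (∀ k, Above 1 (b k)) ∧ ∀ k, Above 2 (b k - a k) := by
  set f := swapStep d m τ a with hf
  have h1 : ∀ j k, Above (j + 1) (f^[j + 1] 0 k - f^[j] 0 k) := by
    intro j
    induction j with
    | zero =>
      intro k
      simpa [hf, swapStep_zero] using ha k
    | succ j ih =>
      intro k
      rw [Function.iterate_succ_apply', Function.iterate_succ_apply' f j]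
      rw [Function.iterate_succ_apply'] at ih
      exact above_swapStep_sub ha ih k
  have h2 : f (f^[n] 0) = f^[n] 0 := by
    rw [← Function.iterate_succ_apply' f]
    ext1 k
    exact sub_eq_zero.mp ((h1 n k).eq_zero (by omega))
  have h3 : ∀ j k, Above 1 (f^[j] 0 k) := by
    intro j
    induction j with
    | zero => exact fun k => Above.of_zero 1
    | succ j ih =>
      intro k
      rw [← sub_add_cancel (f^[j + 1] 0 k) (f^[j] 0 k)]
      exact ((h1 j k).mono (by omega)).add (ih k)
  refine ⟨f^[n] 0, _, isSwap_of_swapStep_eq h2, h3 n, fun k => ?_⟩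
  have h4 := above_swapStep_sub (d := d) (m := m) (τ := τ) (b := f^[n] 0) (b' := 0) ha (j := 1)
    (fun k => by simpa using h3 n k) k
  rw [swapStep_zero] at h4
  exact h2 ▸ h4

end Existence

section Specialisation

variable {S Λ : Type*} [CommRing S] [Ring Λ] [Algebra S Λ] {d m D : ℕ} {a b U : ℕ → Λ}

theorem geomFactor_zero (hD : 0 < D) (a : ℕ → Λ) : geomFactor D (0 : S) a = 1 := by
  obtain ⟨D, rfl⟩ := Nat.exists_eq_succ_of_ne_zero hD.ne'
  rw [geomFactor, Finset.sum_range_succ']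
  simp

theorem letterFactor_zero (a : ℕ → Λ) : letterFactor d m (0 : S) a = 1 + a 0 := by
  rw [letterFactor, Finset.sum_range_succ']
  simp

theorem letterFactor_neg_one (a : ℕ → Λ) : letterFactor 1 m (-1 : S) a = 1 := by
  simp [letterFactor]

theorem IsSwap.eq_of_zero (h : IsSwap d m (0 : S) a b U) {k : ℕ} (hk : k ≤ m) : b k = a k := by
  cases k with
  | zero => simpa using h.zero
  | succ k => simpa using h.succ k hk

/-- At `τ = -1` the substitution is the conjugation by `1 + a_0`. -/
theorem IsSwap.semiconjBy_of_neg_one (h : IsSwap 1 m (-1 : S) a b U) {k : ℕ} (hk : k ≤ m) :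
    SemiconjBy (1 + a 0) (a k) (b k) := by
  have h0 : b 0 = a 0 := by simpa using h.zero
  cases k with
  | zero =>
    rw [h0]
    exact (SemiconjBy.one_left _).add_left (SemiconjBy.eq rfl)
  | succ k =>
    have h1 := h.succ k hk
    rw [h.step k hk, h0] at h1
    have h2 : b (k + 1) + b (k + 1) * a 0 = a (k + 1) + a 0 * a (k + 1) := by
      simp only [neg_smul, one_smul] at h1
      nth_rewrite 1 [h1]
      abel
    rw [SemiconjBy, mul_add, add_mul, one_mul, mul_one, h2]

theorem semiconjBy_list_prod {ι : Type*} {x : Λ} {f g : ι → Λ} (h : ∀ i, SemiconjBy x (f i) (g i))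
    (l : List ι) : SemiconjBy x (l.map f).prod (l.map g).prod := by
  induction l with
  | nil => simp
  | cons i l ih => simpa using (h i).mul_right ih

end Specialisation

section MapMatrix

variable {S S' : Type*} [CommRing S] [CommRing S'] {n : ℕ} (f : S →+* S')

theorem mapMatrix_smul (s : S) (M : Matrix (Fin n) (Fin n) S) :
    f.mapMatrix (s • M) = f s • f.mapMatrix M := by
  ext; simp

theorem mapMatrix_geomFactor (D : ℕ) (s : S) (b : ℕ → Matrix (Fin n) (Fin n) S) :
    f.mapMatrix (geomFactor D s b) = geomFactor D (f s) fun k => f.mapMatrix (b k) := by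
  simp only [geomFactor, map_sum, map_pow, mapMatrix_smul]

theorem mapMatrix_letterFactor (d m : ℕ) (s : S) (b : ℕ → Matrix (Fin n) (Fin n) S) :
    f.mapMatrix (letterFactor d m s b) = letterFactor d m (f s) fun k => f.mapMatrix (b k) := by
  simp only [letterFactor, map_add, map_one, map_sum, mapMatrix_smul, map_mul, map_pow]

end MapMatrix

/-- The corner entry vanishes on the left ideal generated by the letter `0` of a word that does not
end in `0`. -/
theorem mul_letterMat_zero_corner {S : Type*} [CommRing S] {w : List ℕ}
    (hw : w.getLast? ≠ some 0) (M : Matrix (Fin (w.length + 1)) (Fin (w.length + 1)) S)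
    (p : Fin (w.length + 1)) : (M * letterMat S w 0) p (Fin.last _) = 0 := by
  rcases Nat.eq_zero_or_pos w.length with h | h
  · exact mul_letterMat_apply_zero w 0 M p _ (by simpa using h)
  · rw [mul_letterMat_apply_succ w 0 M p ⟨w.length - 1, by omega⟩ _
      (by simp only [Fin.val_last]; omega), if_neg]
    rwa [← List.getLast?_eq_getElem?]

/-! ### Recursion in the truncation parameter -/

/-- The coefficient of the word `w` in the product with truncation parameter `N`, read off from the
representation of the letters by `letterMat w`. The geometric series are cut off at exponent `D`,
which is harmless for `w.length < D`. -/
noncomputable def wordVal (d m D N : ℕ) (w : List ℕ) : ℚ⟦X⟧ :=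
  partProd d m D qfrac N (letterMat ℚ⟦X⟧ w) (N - 1) 0 (Fin.last _)

theorem freeProd_coeff (d m D N : ℕ) (v : FreeMonoid (Fin (m + 1))) :
    (freeProd d m D qfrac N (N - 1)).coeff v = wordVal d m D N (v.toList.map Fin.val) := by
  classical
  rw [wordVal, partProd_eq_sum, Finsupp.sum, Matrix.sum_apply]
  have h : ∀ u : FreeMonoid (Fin (m + 1)),
      ((u.toList.map fun i : Fin (m + 1) => letterMat ℚ⟦X⟧ (v.toList.map Fin.val) i).prod) 0
        (Fin.last _) = if u = v then 1 else 0 := by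
    intro u
    rw [show (fun i : Fin (m + 1) => letterMat ℚ⟦X⟧ (v.toList.map Fin.val) i) =
      letterMat ℚ⟦X⟧ (v.toList.map Fin.val) ∘ Fin.val from rfl, ← List.map_map,
      prod_letterMat_corner]
    congr 1
    rw [eq_iff_iff, (List.map_injective_iff.mpr Fin.val_injective).eq_iff]
    exact FreeMonoid.toList.injective.eq_iff
  simp only [Matrix.smul_apply, h, smul_eq_mul, mul_ite, mul_one, mul_zero]
  rw [Finset.sum_ite_eq']
  split_ifs with h'
  · rfl
  · simpa using h'

/-- The recursion in `N` of the coefficients. Its coefficients are polynomials in `t_N` that vanish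
at `t_N = 0`, and for `d = 1` also at `t_N = -1`, apart from the leading term: at these two values
of `τ` the step from `N` to `N + 1` is trivial modulo the left ideal generated by the letter `0`. -/
theorem exists_wordVal_succ {d m D : ℕ} (hd : d ≤ 1) {w : List ℕ} (hD : w.length < D)
    (hw : w.getLast? ≠ some 0) :
    ∃ c : List (Fin (m + 1)) → Polynomial ℚ,
      (∀ N, 1 ≤ N → wordVal d m D (N + 1) w =
        ∑ v ∈ (List.finite_length_le (Fin (m + 1)) w.length).toFinset,
          Polynomial.aeval (qfrac N) (c v) * wordVal d m D N (v.map Fin.val)) ∧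
      (∀ v, v.length = w.length → c v = if v.map Fin.val = w then 1 else 0) ∧
      (∀ v, v.getLast? = some 0 → c v = 0) ∧
      (∀ v, v.length < w.length → Polynomial.X * (1 + Polynomial.X) ^ d ∣ c v) := by
  set a := letterMat (Polynomial ℚ) w with ha
  have ha1 : ∀ k, Above 1 (a k) := above_letterMat w
  obtain ⟨b, U, hsw, hb1, hb2⟩ := exists_isSwap d m (Polynomial.X : Polynomial ℚ) ha1
  have hprodmap : ∀ v : List (Fin (m + 1)), (v.map fun i : Fin (m + 1) => a i).prod 0 (Fin.last _) =
      if v.map Fin.val = w then 1 else 0 := by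
    intro v
    rw [← prod_letterMat_corner, List.map_map]
    rfl
  have hK : Above 1 (geomFactor D (Polynomial.X : Polynomial ℚ) a - 1) := by
    obtain ⟨D, rfl⟩ := Nat.exists_eq_succ_of_ne_zero (show D ≠ 0 by omega)
    rw [geomFactor, Finset.sum_range_succ', pow_zero, add_sub_cancel_right]
    exact Above.sum fun j _ => (((ha1 0).smul _).pow _).mono (by omega)
  have hL : Above 1 (letterFactor d m (Polynomial.X : Polynomial ℚ) a - 1) := by
    rw [letterFactor, add_sub_cancel_left]
    exact Above.sum fun k _ => (ha1 k).smul _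
  have hK0 : Above 0 (geomFactor D (Polynomial.X : Polynomial ℚ) a) := by
    simpa using (hK.mono (Nat.zero_le 1)).add Above.one
  have hL0 : Above 0 (letterFactor d m (Polynomial.X : Polynomial ℚ) a) := by
    simpa using (hL.mono (Nat.zero_le 1)).add Above.one
  have hbv : ∀ v : List (Fin (m + 1)), Above v.length (v.map fun i : Fin (m + 1) => b i).prod :=
    Above.list_prod fun i => hb1 i
  let M : List (Fin (m + 1)) → Matrix (Fin (w.length + 1)) (Fin (w.length + 1)) (Polynomial ℚ) :=
    fun v => geomFactor D (Polynomial.X : Polynomial ℚ) a *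
      (v.map fun i : Fin (m + 1) => b i).prod * letterFactor d m (Polynomial.X : Polynomial ℚ) a
  have hM : ∀ v, Above v.length (M v) := fun v => by
    simpa using (hK0.mul (hbv v)).mul hL0
  have hmap : ∀ {S' : Type} [CommRing S'] (f : Polynomial ℚ →+* S') (v : List (Fin (m + 1))),
      f.mapMatrix (M v) = geomFactor D (f Polynomial.X) (letterMat S' w) *
        (v.map fun i : Fin (m + 1) => f.mapMatrix (b i)).prod *
          letterFactor d m (f Polynomial.X) (letterMat S' w) := by
    intro S' _ f v
    simp only [M, map_mul, mapMatrix_geomFactor, mapMatrix_letterFactor, map_list_prod,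
      List.map_map, ha, letterMat_map]
    rfl
  have hmapsw : ∀ {S' : Type} [CommRing S'] (f : Polynomial ℚ →+* S'),
      IsSwap d m (f Polynomial.X) (letterMat S' w) (fun k => f.mapMatrix (b k))
        (fun k => f.mapMatrix (U k)) := by
    intro S' _ f
    have h := hsw.map f f.mapMatrix (mapMatrix_smul f)
    simp only [ha, letterMat_map] at h
    exact h
  refine ⟨fun v => M v 0 (Fin.last _), ?_, ?_, ?_, ?_⟩
  · intro N hN
    set f : Polynomial ℚ →+* ℚ⟦X⟧ := (Polynomial.aeval (qfrac N)).toRingHom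
      with hf
    have hfX : f Polynomial.X = qfrac N := by simp [hf]
    have hs := hmapsw f
    rw [hfX] at hs
    have hnil : ∀ {A : Matrix (Fin (w.length + 1)) (Fin (w.length + 1)) ℚ⟦X⟧}, Above 1 A →
        A ^ D = 0 := fun hA => (hA.pow D).eq_zero (by omega)
    have hfb : Above 1 (f.mapMatrix (b 0)) := fun p q hpq => by
      simp [hb1 0 p q hpq]
    have key := geomFactor_mul_partProd_mul_letterFactor (d := d) (m := m) (D := D) (t := qfrac)
      (N := N) (a := letterMat ℚ⟦X⟧ w) (b := fun k => f.mapMatrix (b k))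
      (fun n hn hnN => hs.swap hd (hnil (above_letterMat w 0)) (hnil hfb) (by
        rw [qfrac_mul_qfrac (by omega) (by omega), Nat.sub_add_cancel hnN.le]))
      (n := N - 1) (by omega)
    rw [Nat.sub_add_cancel hN] at key
    rw [wordVal, Nat.add_sub_cancel, ← key, partProd_eq_sum, Finsupp.mul_sum, Finsupp.sum_mul,
      Finsupp.sum, Matrix.sum_apply]
    have hterm : ∀ v : FreeMonoid (Fin (m + 1)),
        (geomFactor D (qfrac N) (letterMat ℚ⟦X⟧ w) *
          ((freeProd d m D qfrac N (N - 1)).coeff v •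
            (v.toList.map fun i : Fin (m + 1) => f.mapMatrix (b i)).prod) *
          letterFactor d m (qfrac N) (letterMat ℚ⟦X⟧ w)) 0 (Fin.last _) =
        f (M v.toList 0 (Fin.last _)) * (freeProd d m D qfrac N (N - 1)).coeff v := by
      intro v
      rw [mul_smul_comm, smul_mul_assoc, ← hfX, ← hmap f, Matrix.smul_apply, smul_eq_mul, mul_comm]
      rfl
    simp only [hterm]
    have e1 : ∀ v : List (Fin (m + 1)), wordVal d m D N (v.map Fin.val) =
        (freeProd d m D qfrac N (N - 1)).coeff (FreeMonoid.ofList v) := fun v => by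
      rw [freeProd_coeff]; rfl
    simp only [e1]
    let g : FreeMonoid (Fin (m + 1)) → ℚ⟦X⟧ := fun v =>
      f (M v.toList 0 (Fin.last _)) * (freeProd d m D qfrac N (N - 1)).coeff v
    refine (finsum_eq_sum_of_support_subset g ?_).symm.trans
      (finsum_eq_sum_of_support_subset g ?_)
    · intro v hv
      simpa using right_ne_zero_of_mul hv
    · intro v hv
      have hv' : f (M v.toList 0 (Fin.last _)) ≠ 0 := left_ne_zero_of_mul hv
      have hle : v.toList.length ≤ w.length := by
        by_contra hlt
        rw [(hM v.toList).eq_zero (by omega)] at hv'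
        simp at hv'
      exact (Set.Finite.mem_toFinset (List.finite_length_le (Fin (m + 1)) w.length)).mpr hle
  · intro v hv
    -- in the corner only the terms of lowest order in the letters survive
    have h1 : Above (w.length + 1) (M v - (v.map fun i : Fin (m + 1) => a i).prod) := by
      have h2 : M v - (v.map fun i : Fin (m + 1) => a i).prod =
          (geomFactor D (Polynomial.X : Polynomial ℚ) a - 1) *
            (v.map fun i : Fin (m + 1) => b i).prod *
              letterFactor d m (Polynomial.X : Polynomial ℚ) a +
          (v.map fun i : Fin (m + 1) => b i).prod *
            (letterFactor d m (Polynomial.X : Polynomial ℚ) a - 1) +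
          ((v.map fun i : Fin (m + 1) => b i).prod -
            (v.map fun i : Fin (m + 1) => a i).prod) := by
        simp only [M]
        noncomm_ring
      rw [h2]
      refine Above.add (Above.add ?_ ?_) ?_
      · exact ((hK.mul (hbv v)).mul hL0).mono (by omega)
      · exact ((hbv v).mul hL).mono (by omega)
      · exact Above.mono (show w.length + 1 ≤ v.length + 1 by omega)
          (Above.list_prod_sub (f := fun i : Fin (m + 1) => b i) (g := fun i => a i)
            (fun i => hb1 i) (fun i => ha1 i) (fun i => hb2 i) v)
    rw [← hprodmap v]
    have h3 := h1.eq_zero le_rfl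
    rw [sub_eq_zero] at h3
    exact congrFun (congrFun h3 0) _
  · intro v hv
    -- the left ideal generated by the letter `0` is preserved
    obtain ⟨v', rfl⟩ := List.getLast?_eq_some_iff.mp hv
    simp only [M, List.map_append, List.map_cons, List.map_nil, List.prod_append, List.prod_cons,
      List.prod_nil, mul_one, Fin.val_zero]
    rw [mul_assoc, mul_assoc, hsw.zero_mul_letterFactor, ← mul_assoc, ← mul_assoc]
    exact mul_letterMat_zero_corner hw _ _
  · intro v hv
    have hne : v.map Fin.val ≠ w := by
      rintro rfl
      simp at hv
    have hcorner : ∀ {S' : Type} [CommRing S'],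
        (v.map fun i : Fin (m + 1) => letterMat S' w i).prod 0 (Fin.last _) = 0 := by
      intro S' _
      have := prod_letterMat_corner (S := S') w (v.map Fin.val)
      rw [if_neg hne, List.map_map] at this
      exact this
    have hadd : ∀ A : Matrix (Fin (w.length + 1)) (Fin (w.length + 1)) ℚ,
        (A * (1 + letterMat ℚ w 0)) 0 (Fin.last _) = A 0 (Fin.last _) := by
      intro A
      rw [mul_add, mul_one, Matrix.add_apply, mul_letterMat_zero_corner hw, add_zero]
    have h0 : Polynomial.X ∣ M v 0 (Fin.last _) := by
      rw [Polynomial.X_dvd_iff, Polynomial.coeff_zero_eq_eval_zero]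
      set f := Polynomial.evalRingHom (0 : ℚ) with hf
      have hfX : f Polynomial.X = 0 := by simp [hf]
      have h1 := hmap f v
      have h2 := hmapsw f
      rw [hfX] at h1 h2
      rw [geomFactor_zero (by omega), letterFactor_zero, one_mul,
        List.map_congr_left fun i _ => h2.eq_of_zero (Nat.lt_succ_iff.mp i.isLt)] at h1
      have h3 := congrFun (congrFun h1 0) (Fin.last _)
      rw [hadd, hcorner] at h3
      exact h3
    obtain rfl | rfl : d = 0 ∨ d = 1 := by omega
    · simpa using h0
    · have h1 : (1 + Polynomial.X : Polynomial ℚ) ∣ M v 0 (Fin.last _) := by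
        rw [show (1 + Polynomial.X : Polynomial ℚ) = Polynomial.X - Polynomial.C (-1) by
          simp [add_comm], Polynomial.dvd_iff_isRoot, Polynomial.IsRoot]
        set f := Polynomial.evalRingHom (-1 : ℚ) with hf
        have hfX : f Polynomial.X = -1 := by simp [hf]
        have h1 := hmap f v
        have h2 := hmapsw f
        rw [hfX] at h1 h2
        rw [letterFactor_neg_one, mul_one] at h1
        have h3 := semiconjBy_list_prod
          (fun i : Fin (m + 1) => h2.semiconjBy_of_neg_one (Nat.lt_succ_iff.mp i.isLt)) v
        have h4 : geomFactor D (-1 : ℚ) (letterMat ℚ w) * (1 + letterMat ℚ w 0) = 1 := by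
          have := geomFactor_mul (S := ℚ) (D := D) (b := letterMat ℚ w)
            (((above_letterMat w 0).pow D).eq_zero (by omega)) (-1)
          simpa using this
        have h5 := hadd (f.mapMatrix (M v))
        rw [h1, mul_assoc, ← h3.eq, ← mul_assoc, h4, one_mul, hcorner, ← h1] at h5
        exact h5.symm
      rw [pow_one]
      refine IsCoprime.mul_dvd ⟨-1, 1, by ring⟩ h0 h1

/-- Summing the recursion expresses the coefficients through truncated sums in which every
polynomial is divisible by the variable. -/
theorem wordVal_mem_circSeq {d m D : ℕ} (hd : d ≤ 1) (w : List (Fin (m + 1)))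
    (hD : w.length < D) (hw : w.getLast? ≠ some 0) :
    (fun N => wordVal d m D N (w.map Fin.val)) ∈ circSeq d := by
  classical
  induction hl : w.length using Nat.strong_induction_on generalizing w with
  | _ l ih =>
  subst hl
  obtain ⟨c, h1, h2, h3, h4⟩ := exists_wordVal_succ (m := m) (w := w.map Fin.val) (D := D) hd
    (by simpa using hD) (by
      rw [List.getLast?_map]
      intro h
      obtain ⟨x, hx, hx0⟩ := Option.map_eq_some_iff.mp h
      exact hw (hx.trans (congrArg some (Fin.ext hx0))))
  simp only [List.length_map] at h1 h2 h4
  set V := (List.finite_length_le (Fin (m + 1)) w.length).toFinset.filter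
    fun v => v.length < w.length with hV
  have hstep : ∀ N, 1 ≤ N → wordVal d m D (N + 1) (w.map Fin.val) =
      wordVal d m D N (w.map Fin.val) + ∑ v ∈ V,
        Polynomial.aeval (qfrac N) (c v) * wordVal d m D N (v.map Fin.val) := by
    intro N hN
    rw [h1 N hN, ← Finset.sum_filter_not_add_sum_filter _ (fun v => v.length < w.length)]
    congr 1
    rw [Finset.sum_eq_single w]
    · rw [h2 w rfl]; simp
    · intro v hv hvw
      simp only [Finset.mem_filter, Set.Finite.mem_toFinset, not_lt] at hv
      rw [h2 v (le_antisymm hv.1 hv.2), if_neg]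
      · simp
      · exact fun h => hvw (List.map_injective_iff.mpr Fin.val_injective h)
    · intro h
      exact absurd (by simp) h
  have hsum : (fun N => wordVal d m D N (w.map Fin.val)) =
      (if w = [] then (1 : ℚ) else 0) • (1 : ℕ → ℚ⟦X⟧) +
        ∑ v ∈ V, sumOp (c v) fun N => wordVal d m D N (v.map Fin.val) := by
    have hone : ∀ N, N ≤ 1 → wordVal d m D N (w.map Fin.val) = if w = [] then 1 else 0 := by
      intro N hN
      rw [wordVal, show N - 1 = 0 by omega, partProd, Matrix.one_apply]
      congr 1
      rw [Fin.ext_iff, eq_comm (a := ((0 : Fin _) : ℕ))]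
      simp
    ext1 N
    simp only [Pi.add_apply, Pi.smul_apply, Pi.one_apply, Finset.sum_apply, sumOp_apply]
    rcases Nat.eq_zero_or_pos N with rfl | hN
    · rw [hone 0 (by omega)]
      simp
    · induction N, hN using Nat.le_induction with
      | base => rw [hone 1 le_rfl]; simp
      | succ N hN ihN =>
        rw [hstep N hN, ihN, add_assoc, ← Finset.sum_add_distrib]
        congr 1
        refine Finset.sum_congr rfl fun v _ => ?_
        rw [Finset.sum_Ico_succ_top hN]
  rw [hsum]
  refine Submodule.add_mem _ (Submodule.smul_mem _ _ (one_mem_circSeq d))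
    (Submodule.sum_mem _ fun v hv => ?_)
  have hvl : v.length < w.length := (Finset.mem_filter.mp hv).2
  by_cases hv0 : v.getLast? = some 0
  · rw [h3 v hv0, map_zero]
    exact Submodule.zero_mem _
  · exact sumOp_mem_circSeq (h4 v hvl) (ih v.length hvl v (by omega) hv0 rfl)

/-! ### The limit of the coefficients -/

/-- The truncated multiple sums over `0 < n_1 < ⋯ < n_r < N` of `∏ (1 + t_{n_j})^d t_{n_j}^{v_j}`,
the exponents being listed from `v_r` to `v_1`. -/
noncomputable def strictSeq (d : ℕ) : List ℕ → ℕ → ℚ⟦X⟧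
  | [] => 1
  | k :: v => sumOp ((1 + Polynomial.X) ^ d * Polynomial.X ^ k) (strictSeq d v)

theorem geomFactor_one {S Λ : Type*} [CommRing S] [Ring Λ] [Algebra S Λ] (s : S) (b : ℕ → Λ) :
    geomFactor 1 s b = 1 := by
  simp [geomFactor]

theorem mul_letterFactor_apply {S : Type*} [CommRing S] {d m : ℕ} (s : S) {w : List ℕ}
    (M : Matrix (Fin (w.length + 1)) (Fin (w.length + 1)) S) {p q r : Fin (w.length + 1)}
    (hq : (q : ℕ) = r + 1) {k : ℕ} (hk : w[(r : ℕ)]? = some k) (hkm : k ≤ m) :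
    (M * letterFactor d m s (letterMat S w)) p q = M p q + (1 + s) ^ d * s ^ k * M p r := by
  rw [letterFactor, mul_add, mul_one, Matrix.add_apply, Finset.mul_sum, Matrix.sum_apply]
  congr 1
  rw [Finset.sum_eq_single k]
  · rw [mul_smul_comm, Matrix.smul_apply, mul_letterMat_apply_succ w k M p r q hq, if_pos hk,
      smul_eq_mul]
  · intro j _ hj
    rw [mul_smul_comm, Matrix.smul_apply, mul_letterMat_apply_succ w j M p r q hq, if_neg,
      smul_zero]
    rw [hk]
    exact fun h => hj (Option.some.inj h).symm
  · intro h
    exact absurd (Finset.mem_range.mpr (by omega)) h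

theorem mul_letterFactor_apply_zero {S : Type*} [CommRing S] {d m : ℕ} (s : S) {w : List ℕ}
    (M : Matrix (Fin (w.length + 1)) (Fin (w.length + 1)) S) {p q : Fin (w.length + 1)}
    (hq : (q : ℕ) = 0) : (M * letterFactor d m s (letterMat S w)) p q = M p q := by
  rw [letterFactor, mul_add, mul_one, Matrix.add_apply, Finset.mul_sum, Matrix.sum_apply,
    Finset.sum_eq_zero, add_zero]
  intro k _
  rw [mul_smul_comm, Matrix.smul_apply, mul_letterMat_apply_zero w k M p q hq, smul_zero]

/-- With `D = 1` the geometric factors are trivial and the product generates the strict multiple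
sums. -/
theorem partProd_one_apply {d m N : ℕ} {w : List ℕ} (hw : ∀ k ∈ w, k ≤ m) (n : ℕ)
    (q : Fin (w.length + 1)) :
    partProd d m 1 qfrac N (letterMat ℚ⟦X⟧ w) n 0 q = strictSeq d (w.take q).reverse (n + 1) := by
  induction n generalizing q with
  | zero =>
    rcases Nat.eq_zero_or_pos (q : ℕ) with hq | hq
    · rw [hq, show q = 0 from Fin.ext hq]
      simp [partProd, strictSeq]
    · obtain ⟨r, hr⟩ := Nat.exists_eq_succ_of_ne_zero hq.ne'
      have hrw : r < w.length := by omega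
      rw [hr, Nat.succ_eq_add_one, List.take_succ_eq_append_getElem hrw]
      simp only [List.reverse_append, List.reverse_cons, List.reverse_nil, List.nil_append,
        List.cons_append, strictSeq, sumOp_apply, partProd]
      rw [Matrix.one_apply_ne]
      · simp
      · rintro rfl
        simp at hq
  | succ n ih =>
    rw [partProd, geomFactor_one, mul_one]
    rcases Nat.eq_zero_or_pos (q : ℕ) with hq | hq
    · rw [mul_letterFactor_apply_zero _ _ hq, ih, hq]
      simp [strictSeq]
    · obtain ⟨r, hr⟩ := Nat.exists_eq_succ_of_ne_zero hq.ne'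
      have hrw : r < w.length := by omega
      rw [mul_letterFactor_apply (r := ⟨r, by omega⟩) _ _ hr (List.getElem?_eq_getElem hrw)
        (hw _ (List.getElem_mem hrw)), ih, ih, hr, Nat.succ_eq_add_one,
        List.take_succ_eq_append_getElem hrw]
      simp only [List.reverse_append, List.reverse_cons, List.reverse_nil, List.nil_append,
        List.cons_append, strictSeq, sumOp_apply]
      rw [Finset.sum_Ico_succ_top (show 1 ≤ n + 1 by omega)]
      simp

theorem X_pow_dvd_qfrac {j n : ℕ} (h : j ≤ n) : (X : ℚ⟦X⟧) ^ j ∣ qfrac n :=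
  Dvd.dvd.mul_right (pow_dvd_pow _ h) _

theorem mk_qfrac_eq_zero {j n : ℕ} (h : j ≤ n) :
    Ideal.Quotient.mk (Ideal.span {(X : ℚ⟦X⟧) ^ j}) (qfrac n) = 0 :=
  Ideal.Quotient.eq_zero_iff_mem.mpr (Ideal.mem_span_singleton.mpr (X_pow_dvd_qfrac h))

/-- Modulo `q^j` the first `N - j` geometric factors are trivial. -/
theorem mapMatrix_partProd_eq {d m D N : ℕ} (hD : 0 < D) {s : ℕ}
    (a : ℕ → Matrix (Fin s) (Fin s) ℚ⟦X⟧) {n j : ℕ} (h : n + j ≤ N) :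
    (Ideal.Quotient.mk (Ideal.span {(X : ℚ⟦X⟧) ^ j})).mapMatrix (partProd d m D qfrac N a n) =
      (Ideal.Quotient.mk (Ideal.span {(X : ℚ⟦X⟧) ^ j})).mapMatrix
        (partProd d m 1 qfrac N a n) := by
  induction n with
  | zero => rfl
  | succ n ih =>
    rw [partProd, partProd, map_mul, map_mul, map_mul, map_mul, ih (by omega), geomFactor_one,
      mapMatrix_geomFactor, mk_qfrac_eq_zero (by omega), geomFactor_zero hD, map_one]

/-- If the last letter of `w` is positive, the coefficient of `w` agrees with the strict multiple
sum modulo `q^N`: a summation index `n` in a geometric factor contributes `q^(N-n)`, and it is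
bounded by the last index `n'`, which contributes `q^n'`. -/
theorem X_pow_dvd_partProd_corner_sub {d m D N : ℕ} (hD : 0 < D) {w : List ℕ} {k : ℕ} (hk : k ≠ 0)
    (hkm : k ≤ m) (hw : w.getLast? = some k) {n : ℕ} (hn : n < N) :
    X ^ N ∣ partProd d m D qfrac N (letterMat ℚ⟦X⟧ w) n 0 (Fin.last _) -
      partProd d m 1 qfrac N (letterMat ℚ⟦X⟧ w) n 0 (Fin.last _) := by
  induction n with
  | zero => simp [partProd]
  | succ n ih =>
    have hpos : 0 < w.length := by
      rw [List.length_pos_iff]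
      rintro rfl
      simp at hw
    have hw0 : w.getLast? ≠ some 0 := by
      rw [hw]
      exact fun h => hk (Option.some.inj h)
    have hr : ((Fin.last w.length : Fin (w.length + 1)) : ℕ) =
        ((⟨w.length - 1, by omega⟩ : Fin (w.length + 1)) : ℕ) + 1 := by
      simp only [Fin.val_last]
      omega
    have hwr : w[((⟨w.length - 1, by omega⟩ : Fin (w.length + 1)) : ℕ)]? = some k := by
      rw [← hw, List.getLast?_eq_getElem?]
    rw [partProd, partProd, mul_letterFactor_apply _ _ hr hwr hkm,
      mul_letterFactor_apply _ _ hr hwr hkm, geomFactor_one, mul_one, add_sub_add_comm, ← mul_sub]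
    refine dvd_add ?_ ?_
    · -- the geometric factor does not change entries in the last column
      obtain ⟨D, rfl⟩ := Nat.exists_eq_succ_of_ne_zero hD.ne'
      rw [geomFactor, Finset.sum_range_succ', pow_zero, mul_add, mul_one, Matrix.add_apply]
      simp only [pow_succ]
      rw [← Finset.sum_mul, mul_smul_comm, ← smul_mul_assoc, ← mul_assoc,
        mul_letterMat_zero_corner hw0, zero_add]
      exact ih (by omega)
    · -- the last index contributes `q^(n+1)`, the error in the other entry is `O(q^(N-n-1))`
      have h1 : (X : ℚ⟦X⟧) ^ (n + 1) ∣
          (1 + qfrac (n + 1)) ^ d * qfrac (n + 1) ^ k :=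
        Dvd.dvd.mul_left ((X_pow_dvd_qfrac le_rfl).trans (dvd_pow_self _ hk)) _
      rw [show N = (n + 1) + (N - (n + 1)) by omega, pow_add,
        show (n + 1) + (N - (n + 1)) = N by omega]
      refine mul_dvd_mul h1 ?_
      have h2 : (Ideal.Quotient.mk (Ideal.span {(X : ℚ⟦X⟧) ^ (N - (n + 1))})).mapMatrix
          (partProd d m D qfrac N (letterMat ℚ⟦X⟧ w) n *
            geomFactor D (qfrac (N - (n + 1))) (letterMat ℚ⟦X⟧ w)) =
          (Ideal.Quotient.mk (Ideal.span {(X : ℚ⟦X⟧) ^ (N - (n + 1))})).mapMatrix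
            (partProd d m 1 qfrac N (letterMat ℚ⟦X⟧ w) n) := by
        rw [map_mul, mapMatrix_geomFactor, mk_qfrac_eq_zero le_rfl, geomFactor_zero hD, mul_one,
          mapMatrix_partProd_eq hD _ (by omega)]
      rw [← Ideal.mem_span_singleton, ← Ideal.Quotient.eq_zero_iff_mem, map_sub, sub_eq_zero]
      exact congrFun (congrFun h2 _) _

/-- The elimination of the exponent `0`: only the last exponent `k` is assumed to be positive. -/
theorem limSeq_strictSeq_mem {d : ℕ} (hd : d ≤ 1) {k : ℕ} (hk : k ≠ 0) (v : List ℕ) :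
    limSeq (strictSeq d (k :: v)) ∈ Zcirc d := by
  set w := (k :: v).reverse with hwdef
  set m := (k :: v).sum with hm
  have hle : ∀ j ∈ w, j ≤ m := fun j hj =>
    List.single_le_sum (fun _ _ => Nat.zero_le _) j (List.mem_reverse.mp hj)
  have hlast : w.getLast? = some k := by simp [hwdef]
  obtain ⟨w', hw'⟩ : ∃ w' : List (Fin (m + 1)), w'.map Fin.val = w := by
    refine ⟨w.pmap (fun j hj => ⟨j, Nat.lt_succ_of_le hj⟩) hle, ?_⟩
    rw [List.map_pmap]
    simp
  have hmem := wordVal_mem_circSeq (m := m) (D := w.length + 1) hd w'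
    (by rw [← hw']; simp) (by
      intro h
      have h1 : w.getLast? = some 0 := by rw [← hw', List.getLast?_map, h]; rfl
      rw [hlast] at h1
      exact hk (Option.some.inj h1))
  rw [hw'] at hmem
  rw [← limSeq_congr (g := fun N => wordVal d m (w.length + 1) N w)]
  · exact limSeq_mem_Zcirc hmem
  · intro N hN
    have h1 := X_pow_dvd_partProd_corner_sub (d := d) (D := w.length + 1) (Nat.succ_pos _) hk
      (hle k (by simp [hwdef])) hlast (show N - 1 < N by omega)
    have hrev : w.reverse = k :: v := by simp [hwdef]
    rw [partProd_one_apply hle, Nat.sub_add_cancel hN, Fin.val_last, List.take_length, hrev] at h1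
    exact h1

theorem sumOp_mem_span_strictSeq {d : ℕ} {h : Polynomial ℚ} (hh : (1 + Polynomial.X) ^ d ∣ h)
    {g : ℕ → ℚ⟦X⟧} (hg : g ∈ Submodule.span ℚ (Set.range (strictSeq d))) :
    sumOp h g ∈ Submodule.span ℚ (Set.range (strictSeq d)) := by
  obtain ⟨p, rfl⟩ := hh
  induction p using Polynomial.induction_on' with
  | add p p' hp hp' =>
    rw [mul_add, map_add, LinearMap.add_apply]
    exact Submodule.add_mem _ hp hp'
  | monomial j c =>
    rw [← Polynomial.C_mul_X_pow_eq_monomial, mul_left_comm, ← Polynomial.smul_eq_C_mul, map_smul,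
      LinearMap.smul_apply]
    refine Submodule.smul_mem _ _ ?_
    suffices hs : Submodule.span ℚ (Set.range (strictSeq d)) ≤
        (Submodule.span ℚ (Set.range (strictSeq d))).comap
          (sumOp ((1 + Polynomial.X) ^ d * Polynomial.X ^ j)) from hs hg
    refine Submodule.span_le.mpr ?_
    rintro _ ⟨v, rfl⟩
    exact Submodule.subset_span ⟨j :: v, rfl⟩

theorem truncZeta_mem_span_strictSeq {d r : ℕ} (k : Fin r → ℕ) (Q : Fin r → Polynomial ℚ)
    (h : ∀ j, (Q j).natDegree + d ≤ k j) :
    truncZeta k Q ∈ Submodule.span ℚ (Set.range (strictSeq d)) := by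
  induction r with
  | zero =>
    rw [truncZeta_zero]
    exact Submodule.subset_span ⟨[], rfl⟩
  | succ r ih =>
    have hl := h (Fin.last r)
    rw [← Fin.snoc_init_self k, ← Fin.snoc_init_self Q, truncZeta_snoc_eq_sumOp _ _ (by omega)]
    exact sumOp_mem_span_strictSeq (dvd_toQfrac hl) (ih _ _ fun j => h j.castSucc)

theorem limSeq_sumOp_mem {d : ℕ} (hd : d ≤ 1) {h : Polynomial ℚ}
    (hh : Polynomial.X * (1 + Polynomial.X) ^ d ∣ h)
    {g : ℕ → ℚ⟦X⟧} (hg : g ∈ Submodule.span ℚ (Set.range (strictSeq d))) :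
    limSeq (sumOp h g) ∈ Zcirc d := by
  obtain ⟨p, rfl⟩ := hh
  induction p using Polynomial.induction_on' with
  | add p p' hp hp' =>
    rw [mul_add, map_add, LinearMap.add_apply, map_add]
    exact Submodule.add_mem _ hp hp'
  | monomial j c =>
    rw [← Polynomial.C_mul_X_pow_eq_monomial, mul_left_comm, ← Polynomial.smul_eq_C_mul, map_smul,
      LinearMap.smul_apply, map_smul]
    refine Submodule.smul_mem _ _ ?_
    suffices hs : Submodule.span ℚ (Set.range (strictSeq d)) ≤ (Zcirc d).comap
        (limSeq ∘ₗ sumOp (Polynomial.X * (1 + Polynomial.X) ^ d * Polynomial.X ^ j)) from hs hg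
    refine Submodule.span_le.mpr ?_
    rintro _ ⟨v, rfl⟩
    rw [show Polynomial.X * (1 + Polynomial.X) ^ d * Polynomial.X ^ j =
      (1 + Polynomial.X) ^ d * (Polynomial.X : Polynomial ℚ) ^ (j + 1) by ring]
    exact limSeq_strictSeq_mem hd (Nat.succ_ne_zero j) v

theorem Z_le_Zcirc {d : ℕ} (hd : d ≤ 1) : Z d ≤ Zcirc d := by
  refine Submodule.span_le.mpr ?_
  rintro _ ⟨r, k, Q, h1, h2, h3, rfl⟩
  rcases r with _ | r
  · exact Submodule.subset_span ⟨0, k, Q, h1, h2, fun j => j.elim0, rfl⟩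
  · have hl := h2 (Fin.last r)
    rw [SetLike.mem_coe, ← limSeq_truncZeta h3, ← Fin.snoc_init_self k, ← Fin.snoc_init_self Q,
      truncZeta_snoc_eq_sumOp _ _ (by omega)]
    exact limSeq_sumOp_mem hd (X_mul_dvd_toQfrac hl (h3 _ rfl))
      (truncZeta_mem_span_strictSeq _ _ fun j => h2 j.castSucc)

theorem Zcirc_le_Z (d : ℕ) : Zcirc d ≤ Z d :=
  Submodule.span_mono fun _ ⟨r, k, Q, h1, h2, h3, hf⟩ => ⟨r, k, Q, h1, h2, fun j _ => h3 j, hf⟩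

end QMZV

theorem mainTheorem1 :
    QMZV.Zcirc 0 = QMZV.Z 0 ∧ QMZV.Zcirc 1 = QMZV.Z 1 := by
  exact ⟨le_antisymm (QMZV.Zcirc_le_Z 0) (QMZV.Z_le_Zcirc (by norm_num)),
    le_antisymm (QMZV.Zcirc_le_Z 1) (QMZV.Z_le_Zcirc le_rfl)⟩
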